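/- Let $(\tilde M^{n+1},\tilde g,\tilde\nabla,J)$ be a locally metallic Riemannian manifold: $\tilde\nabla$ is the Levi-Civita connection of $\tilde g$, and $J$ is a $(1,1)$-tensor field such that $J^2=pJ+qI$ for some positive integers $p,q$, $\tilde g(JX,Y)=\tilde g(X,JY)$ for all $X,Y$, and $\tilde\nabla J=0$. Let $M^n$ be a hypersurface (immersed) of $\tilde M^{n+1}$ with induced metric $g$, Levi-Civita connection $\nabla$ of $g$, and a smooth unit normal vector field $\nu$. Suppose that $M$ is a quadratic metric $\phi$-hypersurface, i.e. there are a $(1,1)$-tensor field $\phi$, a $1$-form $\eta$ and a unit vector field $\xi$ on $M$ with $$JX=\phi X+\eta(X)\nu,\qquad J\nu=q\xi+p\nu,\qquad J\xi=\nu$$ for all $X$ tangent to $M$, and $(g,\phi,\eta,\xi)$ is an almost quadratic metric $\phi$-structure on $M$: $$\phi\xi=0,\qquad \phi^2=p\phi+q(I-\eta\otimes\xi),\qquad q\neq0,\quad p^2+4q\neq 0,\qquad g(\phi X,Y)=g(X,\phi Y).$$ Suppose moreover that $M$ is cosymplectic, i.e. the identity $(\nabla_X\phi)Y=\beta\{g(X,\phi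 Y)\xi+\eta(Y)\phi X\}$ holds for all $X,Y$ with $\beta=0$. Then the shape operator $A$ of $M$, given by $AX=-\tilde\nabla_X\nu$, vanishes identically, and $M$ is totally geodesic: $\tilde\nabla_XY=\nabla_XY$ for all vector fields $X,Y$ tangent to $M$. -/

import Mathlib

open Bundle Manifold
open scoped ContDiff

noncomputable section

namespace MetallicHypersurface

section Defs

variable {E : Type*} [NormedAddCommGroup E] [NormedSpace ℝ E]
  {H : Type*} [TopologicalSpace H] {I : ModelWithCorners ℝ E H}
  {M : Type*} [TopologicalSpace M] [ChartedSpace H M] [IsManifold I ∞ M]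
  {E' : Type*} [NormedAddCommGroup E'] [NormedSpace ℝ E']
  {H' : Type*} [TopologicalSpace H'] {I' : ModelWithCorners ℝ E' H'}
  {N : Type*} [TopologicalSpace N] [ChartedSpace H' N] [IsManifold I' ∞ N]

/-- A vector field `X` on `M` is differentiable at the point `x`. -/
def VectorFieldDiffAt (X : Π x : M, TangentSpace I x) (x : M) : Prop :=
  MDifferentiableAt I I.tangent (fun y ↦ (⟨y, X y⟩ : TangentBundle I M)) x

/-- A vector field on `M` is smooth. -/
def IsSmoothVectorField (X : Π x : M, TangentSpace I x) : Prop :=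
  ContMDiff I I.tangent ∞ (fun y ↦ (⟨y, X y⟩ : TangentBundle I M))

/-- A field `K` of endomorphisms of the tangent spaces is smooth,
that is, it is a tensor field of type `(1,1)`. -/
def IsSmoothEndomorphism (K : Π x : M, TangentSpace I x →L[ℝ] TangentSpace I x) : Prop :=
  ContMDiff I (I.prod 𝓘(ℝ, E →L[ℝ] E)) ∞
    (fun x ↦ TotalSpace.mk' (E →L[ℝ] E) (E := fun x : M ↦ TangentSpace I x →L[ℝ] TangentSpace I x)
      x (K x))

/-- A field of linear forms on the tangent spaces is smooth, that is, it is a `1`-form. -/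
def IsSmoothOneForm (η : Π x : M, TangentSpace I x →L[ℝ] ℝ) : Prop :=
  ContMDiff I (I.prod 𝓘(ℝ, E →L[ℝ] ℝ)) ∞
    (fun x ↦ TotalSpace.mk' (E →L[ℝ] ℝ) (E := fun x : M ↦ TangentSpace I x →L[ℝ] ℝ) x (η x))

/-- The covariant derivative of a field `K` of endomorphisms:
`covDerivEndo cov K Y x X = (∇_X K) Y = ∇_X (K Y) - K (∇_X Y)` at the point `x`. -/
def covDerivEndo (cov : CovariantDerivative I E (TangentSpace I : M → Type _))
    (K : Π x : M, TangentSpace I x →L[ℝ] TangentSpace I x)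
    (Y : Π x : M, TangentSpace I x) (x : M) : TangentSpace I x →L[ℝ] TangentSpace I x :=
  cov (fun y ↦ K y (Y y)) x - (K x).comp (cov Y x)

/-- The connection `cov` on `TN` pulled back along `f : M → N`, acting on a vector field `V` along
`f`: `covAlong cov f V x X = ∇_X V` at the point `x`. If `V = ∑ i, Vⁱ • (eᵢ ∘ f)` near `x`, for the
frame `(eᵢ)` of the preferred trivialization of `TN` at `f x`, this is
`∑ i, dVⁱ(X) • eᵢ + ∇_{df X} (∑ i, Vⁱ(x) • eᵢ)`, where `∑ i, Vⁱ(x) • eᵢ` (with constant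
coefficients) is `FiberBundle.extend E' (V x)`. -/
def covAlong (cov : CovariantDerivative I' E' (TangentSpace I' : N → Type _)) (f : M → N)
    (V : Π x : M, TangentSpace I' (f x)) (x : M) :
    TangentSpace I x →L[ℝ] TangentSpace I' (f x) :=
  ((trivializationAt E' (TangentSpace I' : N → Type _) (f x)).symmL ℝ (f x)).comp
      (mvfderiv I (fun y ↦ (trivializationAt E' (TangentSpace I' : N → Type _)
        (f x)).continuousLinearMapAt ℝ (f y) (V y)) x)
    + (cov (FiberBundle.extend E' (V x)) (f x)).comp (mfderiv I I' f x)

instance [FiniteDimensional ℝ E] (x : M) : FiniteDimensional ℝ (TangentSpace I x) :=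
  inferInstanceAs (FiniteDimensional ℝ E)

section Metric

variable [FiniteDimensional ℝ E] [RiemannianBundle (fun x : M ↦ TangentSpace I x)]
  [FiniteDimensional ℝ E'] [RiemannianBundle (fun x : N ↦ TangentSpace I' x)]

/-- `cov` is the Levi-Civita connection of the Riemannian metric of `M`: it is torsion-free, and
compatible with the metric, `X ⟪Y, Z⟫ = ⟪∇_X Y, Z⟫ + ⟪Y, ∇_X Z⟫`. -/
structure IsLeviCivita (cov : CovariantDerivative I E (TangentSpace I : M → Type _)) : Prop where
  torsion_free : cov.torsion = 0
  metric_compatible : ∀ (x : M) (X : TangentSpace I x) (Y Z : Π x : M, TangentSpace I x),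
    VectorFieldDiffAt Y x → VectorFieldDiffAt Z x →
      mvfderiv I (fun y ↦ inner ℝ (Y y) (Z y)) x X
        = inner ℝ (cov Y x X) (Z x) + inner ℝ (Y x) (cov Z x X)

/-- `J` is a metallic structure with parameters `p`, `q`, and the metric is compatible with it. -/
structure IsMetallicRiemannian (p q : ℕ)
    (J : Π x : M, TangentSpace I x →L[ℝ] TangentSpace I x) : Prop where
  p_pos : 0 < p
  q_pos : 0 < q
  smooth : IsSmoothEndomorphism J
  sq : ∀ (x : M) (X : TangentSpace I x), J x (J x X) = (p : ℝ) • J x X + (q : ℝ) • X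
  compatible : ∀ (x : M) (X Y : TangentSpace I x), inner ℝ (J x X) Y = inner ℝ X (J x Y)

/-- A locally metallic Riemannian manifold: a metallic Riemannian structure `J` that is parallel
for the Levi-Civita connection `cov`. -/
structure IsLocallyMetallic (cov : CovariantDerivative I E (TangentSpace I : M → Type _))
    (p q : ℕ) (J : Π x : M, TangentSpace I x →L[ℝ] TangentSpace I x) : Prop
    extends IsMetallicRiemannian p q J where
  leviCivita : IsLeviCivita cov
  parallel : ∀ (x : M) (X : TangentSpace I x) (Y : Π x : M, TangentSpace I x),
    VectorFieldDiffAt Y x → covDerivEndo cov J Y x X = 0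

/-- An almost quadratic metric `φ`-structure `(g, φ, η, ξ)` with constants `a`, `b`. -/
structure IsAlmostQuadraticMetric (a b : ℝ)
    (φ : Π x : M, TangentSpace I x →L[ℝ] TangentSpace I x)
    (η : Π x : M, TangentSpace I x →L[ℝ] ℝ) (ξ : Π x : M, TangentSpace I x) : Prop where
  b_ne_zero : b ≠ 0
  discr_ne_zero : a ^ 2 + 4 * b ≠ 0
  smooth_phi : IsSmoothEndomorphism φ
  smooth_eta : IsSmoothOneForm η
  smooth_xi : IsSmoothVectorField ξ
  unit_xi : ∀ x : M, ‖ξ x‖ = 1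
  phi_xi : ∀ x : M, φ x (ξ x) = 0
  sq : ∀ (x : M) (X : TangentSpace I x), φ x (φ x X) = a • φ x X + b • (X - η x X • ξ x)
  compatible : ∀ (x : M) (X Y : TangentSpace I x), inner ℝ (φ x X) Y = inner ℝ X (φ x Y)

/-- A `(β, φ)`-Kenmotsu quadratic metric manifold: an almost quadratic metric `φ`-structure with
`(∇_X φ) Y = β (g(X, φ Y) ξ + η(Y) φ X)` for the Levi-Civita connection `cov`. -/
structure IsKenmotsuQuadraticMetric
    (cov : CovariantDerivative I E (TangentSpace I : M → Type _)) (a b : ℝ)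
    (φ : Π x : M, TangentSpace I x →L[ℝ] TangentSpace I x)
    (η : Π x : M, TangentSpace I x →L[ℝ] ℝ) (ξ : Π x : M, TangentSpace I x) (β : M → ℝ) : Prop
    extends IsAlmostQuadraticMetric a b φ η ξ where
  leviCivita : IsLeviCivita cov
  smooth_beta : ContMDiff I 𝓘(ℝ, ℝ) ∞ β
  kenmotsu : ∀ (x : M) (X : TangentSpace I x) (Y : Π x : M, TangentSpace I x),
    VectorFieldDiffAt Y x →
      covDerivEndo cov φ Y x X = β x • (inner ℝ X (φ x (Y x)) • ξ x + η x (Y x) • φ x X)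

/-- A cosymplectic quadratic metric manifold: the case `β = 0`. -/
def IsCosymplecticQuadraticMetric
    (cov : CovariantDerivative I E (TangentSpace I : M → Type _)) (a b : ℝ)
    (φ : Π x : M, TangentSpace I x →L[ℝ] TangentSpace I x)
    (η : Π x : M, TangentSpace I x →L[ℝ] ℝ) (ξ : Π x : M, TangentSpace I x) : Prop :=
  IsKenmotsuQuadraticMetric cov a b φ η ξ (fun _ ↦ 0)

/-- `f : M → N` is a smooth isometric immersion (its differential is injective, as it preserves
inner products): `M` is immersed in `N` and carries the induced metric. -/
structure IsIsometricImmersion (f : M → N) : Prop where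
  smooth : ContMDiff I I' ∞ f
  isometric : ∀ (x : M) (X Y : TangentSpace I x),
    inner ℝ (mfderiv I I' f x X) (mfderiv I I' f x Y) = inner ℝ X Y

/-- `ν` is a smooth unit normal vector field along `f : M → N`. -/
structure IsUnitNormal (f : M → N) (ν : Π x : M, TangentSpace I' (f x)) : Prop where
  smooth : ContMDiff I I'.tangent ∞ (fun x ↦ (⟨f x, ν x⟩ : TangentBundle I' N))
  unit : ∀ x : M, ‖ν x‖ = 1
  normal : ∀ (x : M) (X : TangentSpace I x), inner ℝ (mfderiv I I' f x X) (ν x) = 0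

/-- `(φ, η, ξ)` is the structure induced on `M` by the structure `J` of `N` through the isometric
immersion `f` with unit normal `ν`, and it is an almost quadratic metric `φ`-structure. -/
structure IsQuadraticMetricHypersurface (f : M → N) (ν : Π x : M, TangentSpace I' (f x)) (p q : ℕ)
    (J : Π y : N, TangentSpace I' y →L[ℝ] TangentSpace I' y)
    (φ : Π x : M, TangentSpace I x →L[ℝ] TangentSpace I x)
    (η : Π x : M, TangentSpace I x →L[ℝ] ℝ) (ξ : Π x : M, TangentSpace I x) : Prop where
  immersion : IsIsometricImmersion (I := I) (I' := I') f
  unitNormal : IsUnitNormal (I := I) f ν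
  J_tangent : ∀ (x : M) (X : TangentSpace I x),
    J (f x) (mfderiv I I' f x X) = mfderiv I I' f x (φ x X) + η x X • ν x
  J_normal : ∀ x : M, J (f x) (ν x) = (q : ℝ) • mfderiv I I' f x (ξ x) + (p : ℝ) • ν x
  J_xi : ∀ x : M, J (f x) (mfderiv I I' f x (ξ x)) = ν x
  quadratic : IsAlmostQuadraticMetric (p : ℝ) (q : ℝ) φ η ξ

/-- The shape operator `A` of `f : M → N` for the unit normal `ν`: `A X` is the tangential part of
`-∇_X ν`, that is, `⟪A X, Y⟫ = -⟪∇_X ν, df Y⟫` for all tangent vectors `Y`. -/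
def shapeOperator (cov : CovariantDerivative I' E' (TangentSpace I' : N → Type _)) (f : M → N)
    (ν : Π x : M, TangentSpace I' (f x)) (x : M) : TangentSpace I x →ₗ[ℝ] TangentSpace I x :=
  -((mfderiv I I' f x).toLinearMap.adjoint ∘ₗ (covAlong (I := I) cov f ν x).toLinearMap)

/-- `f : M → N` is totally geodesic: its second fundamental form
`∇̃_X (df Y) - df (∇_X Y)` vanishes. -/
def IsTotallyGeodesic (cov' : CovariantDerivative I' E' (TangentSpace I' : N → Type _))
    (cov : CovariantDerivative I E (TangentSpace I : M → Type _)) (f : M → N) : Prop :=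
  ∀ (x : M) (X : TangentSpace I x) (Y : Π x : M, TangentSpace I x), VectorFieldDiffAt Y x →
    covAlong (I := I) cov' f (fun y ↦ mfderiv I I' f y (Y y)) x X = mfderiv I I' f x (cov Y x X)

end Metric

end Defs

end MetallicHypersurface

end

/-! Write `∇̃`, `∇` for the two connections. With `β = 0`, differentiating `φ ξ = 0` gives `φ (∇_X
ξ) = 0`. Since `ξ` is a unit field and `η` is `q` times the metric dual of `ξ` (by self-adjointness
of `J`), also `η (∇_X ξ) = 0`. The formula for `φ²` then leaves `q ∇_X ξ = 0`, so `ξ` is parallel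
(`covDeriv_xi_eq_zero`). Hence `w = ∇̃_X (df ξ)` is normal to `M`. As `J` is parallel and `J (df ξ)
= ν`, one gets `∇̃_X ν = J w`. Pairing with `ν` gives `0 = ⟪w, J ν⟫ = p ⟪w, ν⟫`, so `w = 0` because
`p > 0`, and `∇̃_X ν = 0` (`covAlong_unitNormal_eq_zero`). The shape operator therefore vanishes,
and by the Weingarten equation so does the second fundamental form. The rest establishes the
calculus of the pulled-back connection `covAlong`: Leibniz rules, the chain rule, compatibility with
metric and parallel endomorphisms, absence of torsion, and normality of the second fundamental form.
-/

set_option linter.unusedSectionVars false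

noncomputable section

namespace MetallicHypersurface

open FiberBundle Filter Topology

/-! ### Vector fields along a map and their coordinates. -/

section AlongMap

variable {E : Type*} [NormedAddCommGroup E] [NormedSpace ℝ E]
  {H : Type*} [TopologicalSpace H] {I : ModelWithCorners ℝ E H}
  {M : Type*} [TopologicalSpace M] [ChartedSpace H M]
  {E' : Type*} [NormedAddCommGroup E'] [NormedSpace ℝ E']
  {H' : Type*} [TopologicalSpace H'] {I' : ModelWithCorners ℝ E' H'}
  {N : Type*} [TopologicalSpace N] [ChartedSpace H' N] [IsManifold I' ∞ N]

variable (I I') in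
/-- A vector field `V` along `f` is differentiable at `x`. -/
def DiffAlongAt (f : M → N) (V : Π x : M, TangentSpace I' (f x)) (x : M) : Prop :=
  MDifferentiableAt I I'.tangent (fun y ↦ (⟨f y, V y⟩ : TangentBundle I' N)) x

variable (I') in
/-- The coordinates of a vector field along `f` in the preferred trivialization at `f x`. -/
def coordAlong (f : M → N) (V : Π x : M, TangentSpace I' (f x)) (x y : M) : E' :=
  (trivializationAt E' (TangentSpace I' : N → Type _) (f x)).continuousLinearMapAt ℝ (f y) (V y)

variable {f : M → N} {x : M} {V W : Π x : M, TangentSpace I' (f x)}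

lemma eventually_mem_baseSet (hf : ContinuousAt f x) :
    ∀ᶠ y in 𝓝 x, f y ∈ (trivializationAt E' (TangentSpace I' : N → Type _) (f x)).baseSet :=
  hf.eventually ((trivializationAt E' (TangentSpace I' : N → Type _) (f x)).open_baseSet.mem_nhds
    (mem_baseSet_trivializationAt' (f x)))

/-- The two expressions can differ off the base set, where `continuousLinearMapAt` is zero by
convention; continuity of `f` keeps nearby points inside it. -/
lemma coordAlong_eventuallyEq (hf : ContinuousAt f x) :
    coordAlong I' f V x =ᶠ[𝓝 x] fun y ↦ (trivializationAt E' (TangentSpace I' : N → Type _) (f x)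
      (⟨f y, V y⟩ : TangentBundle I' N)).2 := by
  filter_upwards [eventually_mem_baseSet (I' := I') hf] with y hy
  simp only [coordAlong, Trivialization.continuousLinearMapAt_apply]
  exact congrFun (Trivialization.coe_linearMapAt_of_mem _ hy) _

lemma diffAlongAt_iff : DiffAlongAt I I' f V x ↔
    MDifferentiableAt I I' f x ∧ MDifferentiableAt I 𝓘(ℝ, E') (coordAlong I' f V x) x := by
  rw [DiffAlongAt, mdifferentiableAt_totalSpace]
  refine and_congr_right fun hf ↦ ?_
  exact (coordAlong_eventuallyEq (I' := I') (V := V)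
    hf.continuousAt).mdifferentiableAt_iff.symm

lemma DiffAlongAt.mdifferentiableAt (hV : DiffAlongAt I I' f V x) :
    MDifferentiableAt I I' f x :=
  (diffAlongAt_iff.1 hV).1

lemma DiffAlongAt.coordAlong (hV : DiffAlongAt I I' f V x) :
    MDifferentiableAt I 𝓘(ℝ, E') (coordAlong I' f V x) x :=
  (diffAlongAt_iff.1 hV).2

lemma coordAlong_add :
    coordAlong I' f (V + W) x = coordAlong I' f V x + coordAlong I' f W x := by
  ext y; simp only [coordAlong, Pi.add_apply, map_add]

lemma coordAlong_smul (g : M → ℝ) :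
    coordAlong I' f (fun y ↦ g y • V y) x = g • coordAlong I' f V x := by
  ext y; simp only [coordAlong, Pi.smul_apply', map_smul]

lemma DiffAlongAt.add (hV : DiffAlongAt I I' f V x) (hW : DiffAlongAt I I' f W x) :
    DiffAlongAt I I' f (V + W) x :=
  diffAlongAt_iff.2 ⟨hV.mdifferentiableAt, coordAlong_add (I' := I') (V := V) (W := W) ▸
    hV.coordAlong.add hW.coordAlong⟩

lemma DiffAlongAt.smul {g : M → ℝ} (hg : MDifferentiableAt I 𝓘(ℝ, ℝ) g x)
    (hV : DiffAlongAt I I' f V x) : DiffAlongAt I I' f (fun y ↦ g y • V y) x :=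
  diffAlongAt_iff.2 ⟨hV.mdifferentiableAt, coordAlong_smul (I' := I') (V := V) g ▸
    hg.smul hV.coordAlong⟩

lemma DiffAlongAt.congr (hV : DiffAlongAt I I' f V x) (h : ∀ᶠ y in 𝓝 x, V y = W y) :
    DiffAlongAt I I' f W x :=
  MDifferentiableAt.congr_of_eventuallyEq hV (h.mono fun y hy ↦ by simp only [hy])

lemma VectorFieldDiffAt.diffAlongAt {Z : Π y : N, TangentSpace I' y}
    (hZ : VectorFieldDiffAt Z (f x)) (hf : MDifferentiableAt I I' f x) :
    DiffAlongAt I I' f (fun y ↦ Z (f y)) x :=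
  MDifferentiableAt.comp x hZ hf

lemma vectorFieldDiffAt_extend {y : N} (v : TangentSpace I' y) :
    VectorFieldDiffAt (extend E' v) y :=
  mdifferentiableAt_extend I' E' v

/-- The extension has constant coordinates in the preferred trivialization, so it depends linearly
on `v` there. -/
lemma extend_apply_of_mem {y z : N} (v : TangentSpace I' y)
    (hz : z ∈ (trivializationAt E' (TangentSpace I' : N → Type _) y).baseSet) :
    extend E' v z = (trivializationAt E' (TangentSpace I' : N → Type _) y).symmL ℝ z
      ((trivializationAt E' (TangentSpace I' : N → Type _) y).continuousLinearMapAt ℝ y v) := by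
  have hy := mem_baseSet_trivializationAt' (F := E') (E := (TangentSpace I' : N → Type _)) y
  rw [Trivialization.symmL_apply _ hz, Trivialization.continuousLinearMapAt_apply,
    Trivialization.coe_linearMapAt_of_mem _ hy]
  rfl

/-! ### The pulled-back connection. -/

section Connection

variable (cov : CovariantDerivative I' E' (TangentSpace I' : N → Type _))

/-- With `covDeriv_extend_smul`, this makes the connection term of `covAlong` linear in the value `V
x`. -/
lemma covDeriv_extend_add {y : N} (v w : TangentSpace I' y) :
    cov (extend E' (v + w)) y = cov (extend E' v) y + cov (extend E' w) y := by
  have hv := vectorFieldDiffAt_extend v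
  have hw := vectorFieldDiffAt_extend w
  rw [← cov.isCovariantDerivativeOn.add hv hw (Set.mem_univ _)]
  refine cov.isCovariantDerivativeOn.congr_of_eventuallyEq (vectorFieldDiffAt_extend (v + w))
    (mdifferentiableAt_add_section hv hw) univ_mem ?_
  filter_upwards [eventually_mem_baseSet (I' := I') (f := id) (x := y) continuousAt_id] with z hz
  have hz : z ∈ (trivializationAt E' (TangentSpace I' : N → Type _) y).baseSet := hz
  simp only [Pi.add_apply, extend_apply_of_mem _ hz, map_add]

lemma covDeriv_extend_smul {y : N} (c : ℝ) (v : TangentSpace I' y) :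
    cov (extend E' (c • v)) y = c • cov (extend E' v) y := by
  have hv := vectorFieldDiffAt_extend v
  rw [← cov.isCovariantDerivativeOn.smul_const c hv (Set.mem_univ _)]
  refine cov.isCovariantDerivativeOn.congr_of_eventuallyEq (vectorFieldDiffAt_extend (c • v))
    hv.smul_const_section univ_mem ?_
  filter_upwards [eventually_mem_baseSet (I' := I') (f := id) (x := y) continuousAt_id] with z hz
  have hz : z ∈ (trivializationAt E' (TangentSpace I' : N → Type _) y).baseSet := hz
  simp only [Pi.smul_apply, extend_apply_of_mem _ hz, map_smul]

lemma covAlong_apply (X : TangentSpace I x) : covAlong (I := I) cov f V x X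
    = (trivializationAt E' (TangentSpace I' : N → Type _) (f x)).symmL ℝ (f x)
        (mvfderiv I (coordAlong I' f V x) x X)
      + cov (extend E' (V x)) (f x) (mfderiv I I' f x X) :=
  rfl

lemma symmL_coordAlong : (trivializationAt E' (TangentSpace I' : N → Type _) (f x)).symmL ℝ (f x)
    (coordAlong I' f V x x) = V x :=
  Trivialization.symmL_continuousLinearMapAt _ (mem_baseSet_trivializationAt' (f x)) _

lemma covAlong_add (hV : DiffAlongAt I I' f V x) (hW : DiffAlongAt I I' f W x) :
    covAlong (I := I) cov f (V + W) x = covAlong cov f V x + covAlong cov f W x := by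
  ext X
  simp only [add_apply, covAlong_apply, coordAlong_add,
    mvfderiv_add hV.coordAlong hW.coordAlong, Pi.add_apply, covDeriv_extend_add, map_add]
  abel

lemma covAlong_smul {g : M → ℝ} (hg : MDifferentiableAt I 𝓘(ℝ, ℝ) g x)
    (hV : DiffAlongAt I I' f V x) (X : TangentSpace I x) :
    covAlong (I := I) cov f (fun y ↦ g y • V y) x X
      = g x • covAlong cov f V x X + mvfderiv I g x X • V x := by
  simp only [covAlong_apply, coordAlong_smul, mvfderiv_smul hg hV.coordAlong, covDeriv_extend_smul,
    add_apply, smul_apply, ContinuousLinearMap.smulRight_apply, map_add, map_smul,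
    symmL_coordAlong]
  module

lemma covAlong_congr (h : ∀ᶠ y in 𝓝 x, V y = W y) :
    covAlong (I := I) cov f V x = covAlong cov f W x := by
  have h' : coordAlong I' f V x =ᶠ[𝓝 x] coordAlong I' f W x :=
    h.mono fun y hy ↦ by simp only [coordAlong, hy]
  ext X
  simp only [covAlong_apply, h.self_of_nhds, mvfderiv, h'.mfderiv_eq]
  rfl

section FiniteDimensional

variable [FiniteDimensional ℝ E']

/-- Both sides obey the same Leibniz rule, so their difference is tensorial and depends only on `Z
y`. It can be tested on the constant-coordinate extension of `Z y`, for which the derivative of the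
coordinates vanishes. -/
lemma covDeriv_apply (cov : CovariantDerivative I' E' (TangentSpace I' : N → Type _))
    {Z : Π y : N, TangentSpace I' y} {y : N} (hZ : VectorFieldDiffAt Z y) (X : TangentSpace I' y) :
    cov Z y X = covAlong (I := I') cov id Z y X := by
  let D : (Π y : N, TangentSpace I' y) → TangentSpace I' y :=
    fun Z ↦ covAlong (I := I') cov id Z y X
  have h : TensorialAt I' E' (fun Z : Π y : N, TangentSpace I' y ↦ cov Z y X - D Z) y := by
    constructor
    · intro g Z hg hZ
      have h : D (g • Z) = g y • D Z + mvfderiv I' g y X • Z y := covAlong_smul cov hg hZ X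
      simp only [h, cov.isCovariantDerivativeOn.leibniz hZ hg (Set.mem_univ _), add_apply,
        smul_apply, ContinuousLinearMap.smulRight_apply]
      module
    · intro Z Z' hZ hZ'
      have h : D (Z + Z') = D Z + D Z' := congr($(covAlong_add cov (f := id) hZ hZ') X)
      simp only [h, cov.isCovariantDerivativeOn.add hZ hZ' (Set.mem_univ _), add_apply]
      abel
  have h2 := h.pointwise hZ (vectorFieldDiffAt_extend (Z y)) (extend_apply_self E' (Z y)).symm
  let Z₀ : Π z : N, TangentSpace I' z := extend E' (Z y)
  have h3 : D Z₀ = cov Z₀ y X := by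
    have hc : coordAlong I' id Z₀ y =ᶠ[𝓝 y] fun _ ↦
        (trivializationAt E' (TangentSpace I' : N → Type _) y).continuousLinearMapAt ℝ y (Z y) := by
      filter_upwards [eventually_mem_baseSet (I' := I') (f := id) (x := y) continuousAt_id]
        with z hz
      have hz : z ∈ (trivializationAt E' (TangentSpace I' : N → Type _) y).baseSet := hz
      simp only [coordAlong, id, Z₀, extend_apply_of_mem _ hz]
      exact (trivializationAt E' (TangentSpace I' : N → Type _) y).continuousLinearMapAt_symmL
        hz _
    have h0 : mvfderiv I' (coordAlong I' id Z₀ y) y X = 0 := by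
      rw [mvfderiv, hc.mfderiv_eq, mfderiv_const]
      rfl
    refine (covAlong_apply cov X).trans ?_
    rw [mfderiv_id]
    refine (congrArg₂ _ ((congrArg _ h0).trans (map_zero _)) ?_).trans (zero_add _)
    exact congr(cov (extend E' $(extend_apply_self E' (Z y))) y X)
  rw [show D (extend E' (Z y)) = _ from h3, sub_self] at h2
  exact sub_eq_zero.1 h2

/-- The chain rule for coordinates; with the Leibniz rule and additivity it determines `covAlong`.
-/
lemma covAlong_comp (cov : CovariantDerivative I' E' (TangentSpace I' : N → Type _))
    {Z : Π y : N, TangentSpace I' y} (hZ : VectorFieldDiffAt Z (f x))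
    (hf : MDifferentiableAt I I' f x) (X : TangentSpace I x) :
    covAlong (I := I) cov f (fun y ↦ Z (f y)) x X = cov Z (f x) (mfderiv I I' f x X) := by
  have hZ' : DiffAlongAt I' I' id Z (f x) := hZ
  have h : mvfderiv I (coordAlong I' f (fun y ↦ Z (f y)) x) x X
      = mvfderiv I' (coordAlong I' id Z (f x)) (f x) (mfderiv I I' f x X) :=
    mfderiv_comp_apply x hZ'.coordAlong hf X
  rw [covDeriv_apply cov hZ, covAlong_apply, covAlong_apply, h, mfderiv_id]
  rfl

/-- Near `x`, a vector field along `f` which is differentiable at `x` is a combination of vector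
fields on `N` composed with `f`, so properties of such fields can be proved by induction. -/
theorem DiffAlongAt.induction {P : (Π y : M, TangentSpace I' (f y)) → Prop}
    (congr : ∀ V W, DiffAlongAt I I' f V x → (∀ᶠ y in 𝓝 x, V y = W y) → P V → P W)
    (comp : ∀ Z : Π y : N, TangentSpace I' y, VectorFieldDiffAt Z (f x) → P fun y ↦ Z (f y))
    (smul : ∀ (g : M → ℝ) V, MDifferentiableAt I 𝓘(ℝ, ℝ) g x → DiffAlongAt I I' f V x → P V →
      P fun y ↦ g y • V y)
    (add : ∀ V W, DiffAlongAt I I' f V x → DiffAlongAt I I' f W x → P V → P W → P (V + W))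
    (hV : DiffAlongAt I I' f V x) : P V := by
  classical
  set e := trivializationAt E' (TangentSpace I' : N → Type _) (f x) with he
  have hfx : f x ∈ e.baseSet := mem_baseSet_trivializationAt' (f x)
  let b := Module.finBasis ℝ E'
  have hZ : ∀ i, VectorFieldDiffAt (e.localFrame b i) (f x) := fun i ↦
    (contMDiffAt_localFrame_of_mem (I := I') 1 e b i hfx).mdifferentiableAt one_ne_zero
  let c : Fin (Module.finrank ℝ E') → M → ℝ := fun i y ↦
    (b.coord i).toContinuousLinearMap (MetallicHypersurface.coordAlong I' f V x y)
  have hc : ∀ i, MDifferentiableAt I 𝓘(ℝ, ℝ) (c i) x := fun i ↦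
    ((b.coord i).toContinuousLinearMap.mdifferentiableAt).comp x hV.coordAlong
  have hterm : ∀ i, DiffAlongAt I I' f (fun y ↦ c i y • e.localFrame b i (f y)) x := fun i ↦
    ((hZ i).diffAlongAt hV.mdifferentiableAt).smul (hc i)
  have hsum : ∀ s : Finset (Fin (Module.finrank ℝ E')),
      DiffAlongAt I I' f (fun y ↦ ∑ i ∈ s, c i y • e.localFrame b i (f y)) x ∧
        P fun y ↦ ∑ i ∈ s, c i y • e.localFrame b i (f y) := by
    intro s
    induction s using Finset.induction_on with
    | empty =>
      have h0 : VectorFieldDiffAt (0 : Π y : N, TangentSpace I' y) (f x) :=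
        mdifferentiableAt_zeroSection ..
      simp only [Finset.sum_empty]
      exact ⟨h0.diffAlongAt hV.mdifferentiableAt, comp 0 h0⟩
    | insert a s ha ih =>
      simp only [Finset.sum_insert ha]
      exact ⟨(hterm a).add ih.1, add _ _ (hterm a) ih.1
        (smul _ _ (hc a) ((hZ a).diffAlongAt hV.mdifferentiableAt) (comp _ (hZ a))) ih.2⟩
  -- The expansion in the local frame is valid only on the base set, which is why `P` must be
  -- invariant under local equality.
  refine congr _ V (hsum Finset.univ).1 ?_ (hsum Finset.univ).2
  filter_upwards [eventually_mem_baseSet (I' := I') hV.mdifferentiableAt.continuousAt] with y hy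
  rw [← he] at hy
  have h : V y = e.symmL ℝ (f y) (MetallicHypersurface.coordAlong I' f V x y) :=
    (e.symmL_continuousLinearMapAt hy (V y)).symm
  conv_rhs => rw [h, ← b.sum_repr (MetallicHypersurface.coordAlong I' f V x y), map_sum]
  refine Finset.sum_congr rfl fun i _ ↦ ?_
  rw [map_smul, Trivialization.localFrame_apply_of_mem_baseSet e b hy,
    Trivialization.symmL_apply _ hy]
  rfl

end FiniteDimensional

end Connection

end AlongMap

/-! ### Parallel endomorphisms and the metric along a map. -/

section Compatibility

variable {E : Type*} [NormedAddCommGroup E] [NormedSpace ℝ E]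
  {H : Type*} [TopologicalSpace H] {I : ModelWithCorners ℝ E H}
  {M : Type*} [TopologicalSpace M] [ChartedSpace H M]
  {E' : Type*} [NormedAddCommGroup E'] [NormedSpace ℝ E'] [FiniteDimensional ℝ E']
  {H' : Type*} [TopologicalSpace H'] {I' : ModelWithCorners ℝ E' H'}
  {N : Type*} [TopologicalSpace N] [ChartedSpace H' N] [IsManifold I' ∞ N]
  {f : M → N} {x : M} {V W : Π x : M, TangentSpace I' (f x)}

section Parallel

lemma IsSmoothEndomorphism.vectorFieldDiffAt {J : Π y : N, TangentSpace I' y →L[ℝ] TangentSpace I' y}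
    (hJ : IsSmoothEndomorphism J) {Z : Π y : N, TangentSpace I' y} {y : N}
    (hZ : VectorFieldDiffAt Z y) : VectorFieldDiffAt (fun z ↦ J z (Z z)) y :=
  MDifferentiableAt.clm_bundle_apply (F₁ := E') (F₂ := E')
    (E₁ := (TangentSpace I' : N → Type _)) (E₂ := (TangentSpace I' : N → Type _))
    (ContMDiff.mdifferentiable hJ (by simp) y) hZ

lemma IsSmoothEndomorphism.diffAlongAt {J : Π y : N, TangentSpace I' y →L[ℝ] TangentSpace I' y}
    (hJ : IsSmoothEndomorphism J) (hV : DiffAlongAt I I' f V x) :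
    DiffAlongAt I I' f (fun y ↦ J (f y) (V y)) x :=
  MDifferentiableAt.clm_bundle_apply (F₁ := E') (F₂ := E')
    (E₁ := (TangentSpace I' : N → Type _)) (E₂ := (TangentSpace I' : N → Type _))
    ((ContMDiff.mdifferentiable hJ (by simp) (f x)).comp x hV.mdifferentiableAt) hV

/-- For fields `Z ∘ f` this is the chain rule and parallelism on `N`; both sides follow the same
Leibniz rule and are additive, so the general case follows by induction. -/
theorem covAlong_endomorphism {cov : CovariantDerivative I' E' (TangentSpace I' : N → Type _)}
    {J : Π y : N, TangentSpace I' y →L[ℝ] TangentSpace I' y} (hJ : IsSmoothEndomorphism J)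
    (hpar : ∀ (y : N) (X : TangentSpace I' y) (Y : Π y : N, TangentSpace I' y),
      VectorFieldDiffAt Y y → covDerivEndo cov J Y y X = 0)
    (hV : DiffAlongAt I I' f V x) (X : TangentSpace I x) :
    covAlong (I := I) cov f (fun y ↦ J (f y) (V y)) x X = J (f x) (covAlong cov f V x X) := by
  have hf := hV.mdifferentiableAt
  refine hV.induction (P := fun V ↦
    covAlong (I := I) cov f (fun y ↦ J (f y) (V y)) x X = J (f x) (covAlong cov f V x X))
    ?_ ?_ ?_ ?_
  · intro V W hV hVW h
    rw [← covAlong_congr cov hVW, ← h]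
    exact congr($(covAlong_congr cov (hVW.mono fun y hy ↦ by rw [hy])) X)
  · intro Z hZ
    rw [covAlong_comp cov hZ hf]
    refine (covAlong_comp cov (hJ.vectorFieldDiffAt hZ) hf X).trans ?_
    exact sub_eq_zero.1 (hpar (f x) (mfderiv I I' f x X) Z hZ)
  · intro g V hg hV h
    simp only [map_smul]
    rw [covAlong_smul cov hg (hJ.diffAlongAt hV), covAlong_smul cov hg hV, h]
    simp only [map_add, map_smul]
  · intro V W hV hW hV' hW'
    simp only [Pi.add_apply, map_add]
    refine congr($(covAlong_add cov (hJ.diffAlongAt hV) (hJ.diffAlongAt hW)) X).trans ?_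
    rw [covAlong_add cov hV hW]
    simp only [add_apply, map_add, hV', hW']

end Parallel

section Metric

variable [RiemannianBundle (fun y : N ↦ TangentSpace I' y)]
  [IsContMDiffRiemannianBundle I' ∞ E' (fun y : N ↦ TangentSpace I' y)]

lemma DiffAlongAt.inner (hV : DiffAlongAt I I' f V x) (hW : DiffAlongAt I I' f W x) :
    MDifferentiableAt I 𝓘(ℝ, ℝ) (fun y ↦ inner ℝ (V y) (W y)) x :=
  haveI : IsContMDiffRiemannianBundle I' 1 E' (fun y : N ↦ TangentSpace I' y) :=
    .of_le (n := ∞) (by simp)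
  MDifferentiableAt.inner_bundle (IB := I') (F := E') (E := fun y : N ↦ TangentSpace I' y) hV hW

/-- A connection compatible with the metric is also compatible along maps. -/
theorem mvfderiv_inner_along {cov : CovariantDerivative I' E' (TangentSpace I' : N → Type _)}
    (hcov : IsLeviCivita cov) (hV : DiffAlongAt I I' f V x) (hW : DiffAlongAt I I' f W x)
    (X : TangentSpace I x) :
    mvfderiv I (fun y ↦ inner ℝ (V y) (W y)) x X
      = inner ℝ (covAlong cov f V x X) (W x) + inner ℝ (V x) (covAlong cov f W x X) := by
  have hf := hV.mdifferentiableAt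
  refine hV.induction (P := fun V ↦ mvfderiv I (fun y ↦ inner ℝ (V y) (W y)) x X
      = inner ℝ (covAlong cov f V x X) (W x) + inner ℝ (V x) (covAlong cov f W x X)) ?_ ?_ ?_ ?_
  · intro V V' hV hVV' h
    have h' : (fun y ↦ inner ℝ (V y) (W y)) =ᶠ[𝓝 x] fun y ↦ inner ℝ (V' y) (W y) :=
      hVV'.mono fun y hy ↦ by simp only [hy]
    rw [← covAlong_congr cov hVV', ← hVV'.self_of_nhds, ← h]
    simp only [mvfderiv, h'.mfderiv_eq]
    rfl
  · intro Z hZ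
    have hZf := hZ.diffAlongAt hf
    -- A second induction, now on `W`, reduces to two fields pulled back from `N`.
    refine hW.induction (P := fun W ↦ mvfderiv I (fun y ↦ inner ℝ (Z (f y)) (W y)) x X
      = inner ℝ (covAlong cov f (fun y ↦ Z (f y)) x X) (W x)
        + inner ℝ (Z (f x)) (covAlong cov f W x X)) ?_ ?_ ?_ ?_
    · intro V V' hV hVV' h
      have h' : (fun y ↦ inner ℝ (Z (f y)) (V y)) =ᶠ[𝓝 x] fun y ↦ inner ℝ (Z (f y)) (V' y) :=
        hVV'.mono fun y hy ↦ by simp only [hy]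
      rw [← covAlong_congr cov hVV', ← hVV'.self_of_nhds, ← h]
      simp only [mvfderiv, h'.mfderiv_eq]
      rfl
    · intro Z' hZ'
      rw [covAlong_comp cov hZ hf, covAlong_comp cov hZ' hf,
        ← hcov.metric_compatible (f x) _ Z Z' hZ hZ']
      exact mfderiv_comp_apply x (DiffAlongAt.inner (I := I') (f := id) hZ hZ') hf X
    · intro g V hg hV h
      simp only [inner_smul_right]
      rw [covAlong_smul cov hg hV]
      refine congr($(mvfderiv_mul hg (hZf.inner hV)) X).trans ?_
      simp only [add_apply, smul_apply, smul_eq_mul, h, inner_add_right, inner_smul_right]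
      ring
    · intro V V' hV hV' h h'
      simp only [Pi.add_apply, inner_add_right]
      rw [covAlong_add cov hV hV']
      refine congr($(mvfderiv_add (hZf.inner hV) (hZf.inner hV')) X).trans ?_
      simp only [add_apply, h, h', inner_add_right]
      ring
  · intro g V hg hV h
    simp only [inner_smul_left]
    rw [covAlong_smul cov hg hV]
    refine congr($(mvfderiv_mul hg (hV.inner hW)) X).trans ?_
    simp only [add_apply, smul_apply, smul_eq_mul, h, inner_add_left, inner_smul_left]
    simp only [conj_trivial]
    ring
  · intro V V' hV hV' h h'
    simp only [Pi.add_apply, inner_add_left]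
    rw [covAlong_add cov hV hV']
    refine congr($(mvfderiv_add (hV.inner hW) (hV'.inner hW)) X).trans ?_
    simp only [add_apply, h, h', inner_add_left]
    ring

end Metric

end Compatibility

/-! ### Torsion along a map. -/

section Torsion

variable {E : Type*} [NormedAddCommGroup E] [NormedSpace ℝ E]
  {H : Type*} [TopologicalSpace H] {I : ModelWithCorners ℝ E H}
  {M : Type*} [TopologicalSpace M] [ChartedSpace H M] [IsManifold I ∞ M]

/-- Vector fields with constant coordinates commute. -/
lemma mlieBracket_extend_extend (x : M) (u v : TangentSpace I x) :
    VectorField.mlieBracket I (extend E u) (extend E v) x = 0 := by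
  -- In the chart at `x` the extension becomes a constant vector field.
  have key : ∀ w : TangentSpace I x,
      VectorField.mpullbackWithin 𝓘(ℝ, E) I (extChartAt I x).symm (extend E w) (Set.range I)
        =ᶠ[𝓝[Set.range I] (extChartAt I x x)]
      fun _ ↦ (trivializationAt E (TangentSpace I : M → Type _) x).continuousLinearMapAt ℝ x w := by
    intro w
    filter_upwards [extChartAt_target_mem_nhdsWithin x] with z hz
    have hz' : (extChartAt I x).symm z ∈ (chartAt H x).source := by
      simpa using (extChartAt I x).map_target hz
    rw [VectorField.mpullbackWithin_apply, extend_apply_of_mem w hz',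
      TangentBundle.symmL_trivializationAt hz', (extChartAt I x).right_inv hz]
    exact (isInvertible_mfderivWithin_extChartAt_symm hz).inverse_apply_eq.2 rfl
  rw [VectorField.mlieBracket, VectorField.mlieBracketWithin_apply, Set.preimage_univ,
    Set.univ_inter]
  have hmem : extChartAt I x x ∈ Set.range I := Set.mem_range_self _
  rw [Filter.EventuallyEq.lieBracketWithin_vectorField_eq (key u) ((key u).self_of_nhdsWithin hmem)
    (key v) ((key v).self_of_nhdsWithin hmem)]
  simp only [VectorField.lieBracketWithin, fderivWithin_const_apply, zero_apply, sub_zero]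
  exact map_zero _

lemma covDeriv_extend_comm [FiniteDimensional ℝ E]
    {cov : CovariantDerivative I E (TangentSpace I : M → Type _)}
    (hcov : cov.torsion = 0) {x : M} (u v : TangentSpace I x) :
    cov (extend E u) x v = cov (extend E v) x u := by
  have h := cov.torsion_apply_eq_extend v u
  rw [hcov, mlieBracket_extend_extend] at h
  simp only [extend_apply_self, sub_zero, Pi.zero_apply, zero_apply] at h
  exact sub_eq_zero.1 h.symm

/-- The second derivatives of a function in directions of constant coordinates are symmetric. -/
lemma mvfderiv_mvfderiv_extend_comm [I.Boundaryless] {F : Type*} [NormedAddCommGroup F]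
    [NormedSpace ℝ F] {G : M → F} {x : M} (hG : ContMDiffAt I 𝓘(ℝ, F) 2 G x)
    (u v : TangentSpace I x) :
    mvfderiv I (fun y ↦ mvfderiv I G y (extend E u y)) x v
      = mvfderiv I (fun y ↦ mvfderiv I G y (extend E v y)) x u := by
  set φ := extChartAt I x with hφ
  set K : E → F := G ∘ φ.symm with hK
  have hKx : ContDiffAt ℝ 2 K (φ x) := by
    have := (contMDiffAt_iff.1 hG).2
    rw [I.range_eq_univ, contDiffWithinAt_univ] at this
    simpa using! this
  set c : TangentSpace I x → E := fun w ↦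
    (trivializationAt E (TangentSpace I : M → Type _) x).continuousLinearMapAt ℝ x w with hc
  have hφx : ∀ w : TangentSpace I x, mfderiv I 𝓘(ℝ, E) φ x w = c w := fun w ↦
    congr($(TangentBundle.continuousLinearMapAt_trivializationAt (mem_chart_source H x)) w).symm
  -- In the chart, differentiating along the extension of `w` is differentiating `K` in the fixed
  -- direction `c w`; symmetry becomes that of the second derivative of `K`.
  have key : ∀ w : TangentSpace I x,
      (fun y ↦ mvfderiv I G y (extend E w y)) =ᶠ[𝓝 x] fun y ↦ fderiv ℝ K (φ y) (c w) := by
    intro w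
    have h1 : ∀ᶠ y in 𝓝 x, DifferentiableAt ℝ K (φ y) :=
      (continuousAt_extChartAt x).eventually
        ((hKx.eventually (by simp)).mono fun z hz ↦ hz.differentiableAt (by simp))
    filter_upwards [h1, (chartAt H x).open_source.mem_nhds (mem_chart_source H x)] with y hy hy'
    have hGK : G =ᶠ[𝓝 y] K ∘ φ := by
      filter_upwards [(chartAt H x).open_source.mem_nhds hy'] with z hz
      simp only [hK, Function.comp_apply]
      rw [φ.left_inv (by simpa [hφ] using hz)]
    have h2 : mfderiv I 𝓘(ℝ, F) G y (extend E w y)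
        = mfderiv 𝓘(ℝ, E) 𝓘(ℝ, F) K (φ y) (mfderiv I 𝓘(ℝ, E) φ y (extend E w y)) := by
      rw [hGK.mfderiv_eq]
      exact mfderiv_comp_apply y hy.mdifferentiableAt (mdifferentiableAt_extChartAt hy') _
    have h3 : mfderiv I 𝓘(ℝ, E) φ y (extend E w y) = c w := by
      rw [extend_apply_of_mem w hy', ← TangentBundle.continuousLinearMapAt_trivializationAt hy']
      exact (trivializationAt E (TangentSpace I : M → Type _) x).continuousLinearMapAt_symmL hy' _
    refine h2.trans ?_
    rw [h3, mfderiv_eq_fderiv]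
    rfl
  have key2 : ∀ w w' : TangentSpace I x, mvfderiv I (fun y ↦ mvfderiv I G y (extend E w y)) x w'
      = fderiv ℝ (fderiv ℝ K) (φ x) (c w') (c w) := by
    intro w w'
    have hd : DifferentiableAt ℝ (fderiv ℝ K) (φ x) :=
      (hKx.fderiv_right (m := 1) (by norm_num)).differentiableAt one_ne_zero
    have hd' : DifferentiableAt ℝ (fun z ↦ fderiv ℝ K z (c w)) (φ x) :=
      hd.clm_apply (differentiableAt_const _)
    have h1 : mfderiv I 𝓘(ℝ, F) ((fun z ↦ fderiv ℝ K z (c w)) ∘ φ) x w'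
        = mfderiv 𝓘(ℝ, E) 𝓘(ℝ, F) (fun z ↦ fderiv ℝ K z (c w)) (φ x)
          (mfderiv I 𝓘(ℝ, E) φ x w') :=
      mfderiv_comp_apply x hd'.mdifferentiableAt
        (mdifferentiableAt_extChartAt (mem_chart_source H x)) _
    have h2 : mvfderiv I (fun y ↦ mvfderiv I G y (extend E w y)) x w'
        = mfderiv I 𝓘(ℝ, F) ((fun z ↦ fderiv ℝ K z (c w)) ∘ φ) x w' := by
      rw [mvfderiv, (key w).mfderiv_eq]
      rfl
    rw [h2, h1, hφx, mfderiv_eq_fderiv]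
    have h3 := fderiv_clm_apply hd (differentiableAt_const (c w))
    refine congr($h3 (c w')).trans ?_
    simp
  rw [key2, key2]
  exact (hKx.isSymmSndFDerivAt (by simp)) _ _

variable {E' : Type*} [NormedAddCommGroup E'] [NormedSpace ℝ E'] [FiniteDimensional ℝ E']
  {H' : Type*} [TopologicalSpace H'] {I' : ModelWithCorners ℝ E' H'}
  {N : Type*} [TopologicalSpace N] [ChartedSpace H' N] [IsManifold I' ∞ N]

/-- A torsion-free connection is torsion-free along maps. -/
theorem covAlong_mfderiv_extend_comm [I.Boundaryless]
    {cov : CovariantDerivative I' E' (TangentSpace I' : N → Type _)} (hcov : cov.torsion = 0)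
    {f : M → N} (hf : ContMDiff I I' ∞ f) {x : M} (u v : TangentSpace I x) :
    covAlong (I := I) cov f (fun y ↦ mfderiv I I' f y (extend E u y)) x v
      = covAlong (I := I) cov f (fun y ↦ mfderiv I I' f y (extend E v y)) x u := by
  have hG : ContMDiffAt I 𝓘(ℝ, E') 2 (extChartAt I' (f x) ∘ f) x :=
    ((contMDiffAt_extChartAt (n := ∞)).comp x (hf x)).of_le (by norm_cast)
  -- The trivialization at `f x` is the differential of the chart, so these coordinates are
  -- derivatives of the chart expression of `f`.
  have key : ∀ w : TangentSpace I x,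
      coordAlong I' f (fun y ↦ mfderiv I I' f y (extend E w y)) x
        =ᶠ[𝓝 x] fun y ↦ mvfderiv I (extChartAt I' (f x) ∘ f) y (extend E w y) := by
    intro w
    filter_upwards [eventually_mem_baseSet (I' := I') hf.continuous.continuousAt] with y hy
    have h := mfderiv_comp_apply y (mdifferentiableAt_extChartAt (I := I') hy)
      (hf.mdifferentiable (by simp) y) (extend E w y)
    rw [coordAlong, TangentBundle.continuousLinearMapAt_trivializationAt hy]
    exact h.symm
  have key2 : ∀ w w' : TangentSpace I x,
      mvfderiv I (coordAlong I' f (fun y ↦ mfderiv I I' f y (extend E w y)) x) x w'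
        = mvfderiv I (fun y ↦ mvfderiv I (extChartAt I' (f x) ∘ f) y (extend E w y)) x w' := by
    intro w w'
    rw [mvfderiv, (key w).mfderiv_eq]
    rfl
  rw [covAlong_apply, covAlong_apply, key2, key2, mvfderiv_mvfderiv_extend_comm hG u v,
    extend_apply_self, extend_apply_self, covDeriv_extend_comm hcov]

end Torsion

/-! ### Second fundamental form and geometry of the hypersurface. -/

section Hypersurface

variable {E : Type*} [NormedAddCommGroup E] [NormedSpace ℝ E] [FiniteDimensional ℝ E]
  {H : Type*} [TopologicalSpace H] {I : ModelWithCorners ℝ E H} [I.Boundaryless]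
  {M : Type*} [TopologicalSpace M] [ChartedSpace H M] [IsManifold I ∞ M]
  [RiemannianBundle (fun x : M ↦ TangentSpace I x)]
  [IsContMDiffRiemannianBundle I ∞ E (fun x : M ↦ TangentSpace I x)]
  {E' : Type*} [NormedAddCommGroup E'] [NormedSpace ℝ E'] [FiniteDimensional ℝ E']
  {H' : Type*} [TopologicalSpace H'] {I' : ModelWithCorners ℝ E' H'}
  {N : Type*} [TopologicalSpace N] [ChartedSpace H' N] [IsManifold I' ∞ N]
  [RiemannianBundle (fun y : N ↦ TangentSpace I' y)]
  [IsContMDiffRiemannianBundle I' ∞ E' (fun y : N ↦ TangentSpace I' y)]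
  {covN : CovariantDerivative I' E' (TangentSpace I' : N → Type _)}
  {covM : CovariantDerivative I E (TangentSpace I : M → Type _)}
  {f : M → N} {x : M}

lemma diffAlongAt_mfderiv (hf : ContMDiff I I' ∞ f) {Y : Π x : M, TangentSpace I x}
    (hY : VectorFieldDiffAt Y x) : DiffAlongAt I I' f (fun y ↦ mfderiv I I' f y (Y y)) x := by
  have h := (hf.contMDiff_tangentMap (m := 1) (by norm_cast)).mdifferentiable one_ne_zero ⟨x, Y x⟩
  exact MDifferentiableAt.comp x h hY

/-- The pairing of `∇̃_X (df Y) - df (∇_X Y)` with `df Z` is antisymmetric in `Y` and `Z`. -/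
lemma inner_secondFundamentalForm_swap (hf : IsIsometricImmersion (I := I) (I' := I') f)
    (hN : IsLeviCivita covN) (hM : IsLeviCivita covM) {Y Z : Π x : M, TangentSpace I x}
    (hY : VectorFieldDiffAt Y x) (hZ : VectorFieldDiffAt Z x) (X : TangentSpace I x) :
    inner ℝ (covAlong covN f (fun y ↦ mfderiv I I' f y (Y y)) x X - mfderiv I I' f x (covM Y x X))
        (mfderiv I I' f x (Z x))
      = -inner ℝ (covAlong covN f (fun y ↦ mfderiv I I' f y (Z y)) x X
          - mfderiv I I' f x (covM Z x X)) (mfderiv I I' f x (Y x)) := by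
  have h1 := mvfderiv_inner_along hN (diffAlongAt_mfderiv hf.smooth hY)
    (diffAlongAt_mfderiv hf.smooth hZ) X
  have h2 := hM.metric_compatible x X Y Z hY hZ
  simp only [hf.isometric] at h1
  rw [h2] at h1
  rw [inner_sub_left, inner_sub_left, hf.isometric, hf.isometric,
    real_inner_comm _ (covAlong covN f (fun y ↦ mfderiv I I' f y (Z y)) x X),
    real_inner_comm _ (covM Z x X)]
  linarith

/-- Alternating the two swaps three times each returns to `S u v w` with three sign changes, as in
the uniqueness of the Levi-Civita connection. -/
lemma trilinear_eq_zero {V : Type*} {S : V → V → V → ℝ} (hsymm : ∀ u v w, S u v w = S v u w)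
    (hanti : ∀ u v w, S u v w = -S u w v) (u v w : V) : S u v w = 0 := by
  linarith [hsymm u v w, hanti u v w, hsymm u w v, hanti w u v, hsymm w v u, hanti v w u,
    hsymm v u w]

/-- The second fundamental form of an isometric immersion takes values normal to the image. -/
theorem inner_secondFundamentalForm_mfderiv (hf : IsIsometricImmersion (I := I) (I' := I') f)
    (hN : IsLeviCivita covN) (hM : IsLeviCivita covM) {Y : Π x : M, TangentSpace I x}
    (hY : VectorFieldDiffAt Y x) (X Z : TangentSpace I x) :
    inner ℝ (covAlong covN f (fun y ↦ mfderiv I I' f y (Y y)) x X - mfderiv I I' f x (covM Y x X))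
        (mfderiv I I' f x Z) = 0 := by
  -- On extensions, symmetry in the first two slots comes from both connections being torsion-free,
  -- antisymmetry in the last two from metric compatibility.
  have h := trilinear_eq_zero (S := fun u v w : TangentSpace I x ↦
    inner ℝ (covAlong covN f (fun y ↦ mfderiv I I' f y (extend E v y)) x u
      - mfderiv I I' f x (covM (extend E v) x u)) (mfderiv I I' f x w))
    (fun u v w ↦ by
      simp only [covAlong_mfderiv_extend_comm hN.torsion_free hf.smooth v u,
        covDeriv_extend_comm hM.torsion_free v u])
    (fun u v w ↦ by
      simpa only [extend_apply_self] using inner_secondFundamentalForm_swap hf hN hM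
        (vectorFieldDiffAt_extend v) (vectorFieldDiffAt_extend w) u)
  -- The swap moves `Y` to the slot where only `Y x` matters, reducing to the case of extensions.
  have h2 := inner_secondFundamentalForm_swap hf hN hM hY (vectorFieldDiffAt_extend Z) X
  rw [extend_apply_self] at h2
  rw [h2, h X Z (Y x), neg_zero]

variable {ν : Π x : M, TangentSpace I' (f x)}

lemma IsUnitNormal.diffAlongAt (hν : IsUnitNormal (I := I) f ν) (x : M) :
    DiffAlongAt I I' f ν x :=
  hν.smooth.mdifferentiable (by simp) x

/-- The derivative of a unit normal field is tangent. -/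
lemma inner_covAlong_unitNormal (hN : IsLeviCivita covN) (hν : IsUnitNormal (I := I) f ν)
    (X : TangentSpace I x) : inner ℝ (covAlong covN f ν x X) (ν x) = 0 := by
  have h := mvfderiv_inner_along hN (hν.diffAlongAt x) (hν.diffAlongAt x) X
  have h1 : (fun y ↦ inner ℝ (ν y) (ν y)) = fun _ : M ↦ (1 : ℝ) := by
    ext y; rw [real_inner_self_eq_norm_sq, hν.unit, one_pow]
  rw [h1, mvfderiv_const, zero_apply, real_inner_comm (covAlong covN f ν x X)] at h
  linarith

/-- The Weingarten equation. -/
lemma inner_covAlong_mfderiv_unitNormal (hf : IsIsometricImmersion (I := I) (I' := I') f)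
    (hN : IsLeviCivita covN) (hν : IsUnitNormal (I := I) f ν) {Y : Π x : M, TangentSpace I x}
    (hY : VectorFieldDiffAt Y x) (X : TangentSpace I x) :
    inner ℝ (covAlong covN f (fun y ↦ mfderiv I I' f y (Y y)) x X) (ν x)
      = -inner ℝ (mfderiv I I' f x (Y x)) (covAlong covN f ν x X) := by
  have h := mvfderiv_inner_along hN (diffAlongAt_mfderiv hf.smooth hY) (hν.diffAlongAt x) X
  simp only [hν.normal] at h
  rw [mvfderiv_const, zero_apply] at h
  linarith

/-- For a hypersurface, a vector orthogonal to the tangent space and to the normal vanishes. -/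
lemma eq_zero_of_inner_eq_zero (hf : IsIsometricImmersion (I := I) (I' := I') f)
    (hν : IsUnitNormal (I := I) f ν) (hdim : Module.finrank ℝ E' = Module.finrank ℝ E + 1)
    {w : TangentSpace I' (f x)} (hw : ∀ Z : TangentSpace I x, inner ℝ w (mfderiv I I' f x Z) = 0)
    (hwν : inner ℝ w (ν x) = 0) : w = 0 := by
  -- `L` is injective by orthogonality, hence onto by the dimension count; thus `w` is itself in the
  -- span it is orthogonal to.
  let L : TangentSpace I x × ℝ →ₗ[ℝ] TangentSpace I' (f x) :=
    (mfderiv I I' f x).toLinearMap.coprod (LinearMap.toSpanSingleton ℝ _ (ν x))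
  have hL : ∀ a, L a = mfderiv I I' f x a.1 + a.2 • ν x := fun a ↦ rfl
  have hinj : Function.Injective L := by
    rw [← LinearMap.ker_eq_bot, LinearMap.ker_eq_bot']
    rintro ⟨Z, c⟩ hZ
    rw [hL] at hZ
    have h1 : inner ℝ (mfderiv I I' f x Z + c • ν x) (ν x) = 0 := by rw [hZ, inner_zero_left]
    have h2 : inner ℝ (mfderiv I I' f x Z + c • ν x) (mfderiv I I' f x Z) = 0 := by
      rw [hZ, inner_zero_left]
    rw [inner_add_left, hν.normal, inner_smul_left, real_inner_self_eq_norm_sq, hν.unit] at h1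
    rw [inner_add_left, inner_smul_left, real_inner_comm _ (ν x), hν.normal, hf.isometric] at h2
    simp at h1 h2
    simp [h1, h2]
  have hsurj : Function.Surjective L := by
    refine (LinearMap.injective_iff_surjective_of_finrank_eq_finrank ?_).1 hinj
    rw [Module.finrank_prod, Module.finrank_self]
    exact hdim.symm
  obtain ⟨a, ha⟩ := hsurj w
  rw [hL] at ha
  have : inner ℝ w (mfderiv I I' f x a.1 + a.2 • ν x) = 0 := by
    rw [inner_add_right, hw, inner_smul_right, hwν, mul_zero, add_zero]
  rw [ha] at this
  exact inner_self_eq_zero.1 this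

/-- On a cosymplectic quadratic metric `φ`-hypersurface of a metallic manifold, `ξ` is parallel. -/
lemma covDeriv_xi_eq_zero {p q : ℕ} {J : Π y : N, TangentSpace I' y →L[ℝ] TangentSpace I' y}
    (hJ : IsLocallyMetallic covN p q J)
    {φ : Π x : M, TangentSpace I x →L[ℝ] TangentSpace I x}
    {η : Π x : M, TangentSpace I x →L[ℝ] ℝ} {ξ : Π x : M, TangentSpace I x}
    (hM : IsQuadraticMetricHypersurface f ν p q J φ η ξ)
    (hcos : IsCosymplecticQuadraticMetric covM (p : ℝ) (q : ℝ) φ η ξ) (X : TangentSpace I x) :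
    covM ξ x X = 0 := by
  have hξ : VectorFieldDiffAt ξ x := hcos.smooth_xi.mdifferentiable (by simp) x
  have hφ : φ x (covM ξ x X) = 0 := by
    have h := hcos.kenmotsu x X ξ hξ
    have h0 : (fun y ↦ φ y (ξ y)) = 0 := funext hcos.phi_xi
    rw [covDerivEndo, h0, covM.zero] at h
    simpa using h
  have hunit : inner ℝ (covM ξ x X) (ξ x) = 0 := by
    have h := hcos.leviCivita.metric_compatible x X ξ ξ hξ hξ
    have h1 : (fun y ↦ inner ℝ (ξ y) (ξ y)) = fun _ : M ↦ (1 : ℝ) := by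
      ext y; rw [real_inner_self_eq_norm_sq, hcos.unit_xi, one_pow]
    rw [h1, mvfderiv_const, zero_apply, real_inner_comm (covM ξ x X)] at h
    linarith
  -- Self-adjointness of `J`, tested on `df u` and `ν`, reads `η u = q ⟪u, ξ⟫`.
  have hη : η x (covM ξ x X) = 0 := by
    have h := hJ.compatible (f x) (mfderiv I I' f x (covM ξ x X)) (ν x)
    rw [hM.J_tangent, hM.J_normal, inner_add_left, hM.unitNormal.normal, inner_smul_left,
      real_inner_self_eq_norm_sq, hM.unitNormal.unit, inner_add_right, inner_smul_right,
      inner_smul_right, hM.immersion.isometric, hunit, hM.unitNormal.normal] at h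
    simpa using h
  have hsq := hcos.sq x (covM ξ x X)
  rw [hφ, map_zero, smul_zero, hη, zero_smul, sub_zero, zero_add, eq_comm, smul_eq_zero] at hsq
  exact hsq.resolve_left hcos.b_ne_zero

/-- The unit normal of a cosymplectic quadratic metric `φ`-hypersurface is parallel. -/
theorem covAlong_unitNormal_eq_zero {p q : ℕ}
    {J : Π y : N, TangentSpace I' y →L[ℝ] TangentSpace I' y}
    (hdim : Module.finrank ℝ E' = Module.finrank ℝ E + 1)
    (hJ : IsLocallyMetallic covN p q J)
    {φ : Π x : M, TangentSpace I x →L[ℝ] TangentSpace I x}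
    {η : Π x : M, TangentSpace I x →L[ℝ] ℝ} {ξ : Π x : M, TangentSpace I x}
    (hM : IsQuadraticMetricHypersurface f ν p q J φ η ξ)
    (hcos : IsCosymplecticQuadraticMetric covM (p : ℝ) (q : ℝ) φ η ξ) :
    covAlong (I := I) covN f ν x = 0 := by
  ext X
  have hf := hM.immersion
  have hν := hM.unitNormal
  have hξ : VectorFieldDiffAt ξ x := hcos.smooth_xi.mdifferentiable (by simp) x
  set w := covAlong (I := I) covN f (fun y ↦ mfderiv I I' f y (ξ y)) x X with hw
  have hwt : ∀ Z, inner ℝ w (mfderiv I I' f x Z) = 0 := by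
    intro Z
    have h := inner_secondFundamentalForm_mfderiv hf hJ.leviCivita hcos.leviCivita hξ X Z
    rwa [covDeriv_xi_eq_zero hJ hM hcos, map_zero, sub_zero] at h
  have hwJ : covAlong (I := I) covN f ν x X = J (f x) w := by
    rw [hw, ← covAlong_endomorphism hJ.smooth hJ.parallel (diffAlongAt_mfderiv hf.smooth hξ) X]
    simp only [hM.J_xi]
  -- Since `∇̃_X ν = J w` is orthogonal to `ν`, moving `J` across gives `q ⟪w, df ξ⟫ + p ⟪w, ν⟫ =
  -- 0`, whose first term vanishes by `hwt`.
  have hwν : inner ℝ w (ν x) = 0 := by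
    have h := inner_covAlong_unitNormal hJ.leviCivita hν (x := x) X
    rw [hwJ, hJ.compatible, hM.J_normal, inner_add_right, inner_smul_right, inner_smul_right,
      hwt, mul_zero, zero_add, mul_eq_zero] at h
    exact h.resolve_left (Nat.cast_ne_zero.2 hJ.p_pos.ne')
  rw [hwJ, eq_zero_of_inner_eq_zero hf hν hdim hwt hwν, map_zero, zero_apply]

end Hypersurface

end MetallicHypersurface

end

theorem mainTheorem9 {n : ℕ}
    -- the ambient Riemannian manifold `N`, of dimension `n + 1`, with a connection
    {N : Type*} [TopologicalSpace N] [ChartedSpace (EuclideanSpace ℝ (Fin (n + 1))) N]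
    [IsManifold (𝓡 (n + 1)) ∞ N] [RiemannianBundle (fun y : N ↦ TangentSpace (𝓡 (n + 1)) y)]
    [IsContMDiffRiemannianBundle (𝓡 (n + 1)) ∞ (EuclideanSpace ℝ (Fin (n + 1)))
      (fun y : N ↦ TangentSpace (𝓡 (n + 1)) y)]
    (covN : CovariantDerivative (𝓡 (n + 1)) (EuclideanSpace ℝ (Fin (n + 1)))
      (TangentSpace (𝓡 (n + 1)) : N → Type _))
    -- the Riemannian manifold `M`, of dimension `n`, with a connection
    {M : Type*} [TopologicalSpace M] [ChartedSpace (EuclideanSpace ℝ (Fin n)) M]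
    [IsManifold (𝓡 n) ∞ M] [RiemannianBundle (fun x : M ↦ TangentSpace (𝓡 n) x)]
    [IsContMDiffRiemannianBundle (𝓡 n) ∞ (EuclideanSpace ℝ (Fin n))
      (fun x : M ↦ TangentSpace (𝓡 n) x)]
    (covM : CovariantDerivative (𝓡 n) (EuclideanSpace ℝ (Fin n))
      (TangentSpace (𝓡 n) : M → Type _))
    (p q : ℕ) (J : Π y : N, TangentSpace (𝓡 (n + 1)) y →L[ℝ] TangentSpace (𝓡 (n + 1)) y)
    (hJ : MetallicHypersurface.IsLocallyMetallic covN p q J)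
    (f : M → N) (ν : Π x : M, TangentSpace (𝓡 (n + 1)) (f x))
    (φ : Π x : M, TangentSpace (𝓡 n) x →L[ℝ] TangentSpace (𝓡 n) x)
    (η : Π x : M, TangentSpace (𝓡 n) x →L[ℝ] ℝ) (ξ : Π x : M, TangentSpace (𝓡 n) x)
    (hM : MetallicHypersurface.IsQuadraticMetricHypersurface f ν p q J φ η ξ)
    (hcos : MetallicHypersurface.IsCosymplecticQuadraticMetric covM (p : ℝ) (q : ℝ) φ η ξ) :
    (∀ x : M, MetallicHypersurface.shapeOperator (I := 𝓡 n) covN f ν x = 0) ∧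
      MetallicHypersurface.IsTotallyGeodesic covN covM f := by
  have hdim : Module.finrank ℝ (EuclideanSpace ℝ (Fin (n + 1)))
      = Module.finrank ℝ (EuclideanSpace ℝ (Fin n)) + 1 := by
    simp
  have hA : ∀ x, MetallicHypersurface.covAlong (I := 𝓡 n) covN f ν x = 0 := fun x ↦
    MetallicHypersurface.covAlong_unitNormal_eq_zero hdim hJ hM hcos
  refine ⟨fun x ↦ ?_, fun x X Y hY ↦ ?_⟩
  · rw [MetallicHypersurface.shapeOperator, hA x]
    ext
    simp
  -- The second fundamental form has no tangential part, and its normal part is controlled by `∇̃ν =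
  -- 0`.
  · refine sub_eq_zero.1 (MetallicHypersurface.eq_zero_of_inner_eq_zero hM.immersion hM.unitNormal
      hdim (fun Z ↦ MetallicHypersurface.inner_secondFundamentalForm_mfderiv hM.immersion
        hJ.leviCivita hcos.leviCivita hY X Z) ?_)
    rw [inner_sub_left, hM.unitNormal.normal, sub_zero,
      MetallicHypersurface.inner_covAlong_mfderiv_unitNormal hM.immersion hJ.leviCivita
        hM.unitNormal hY, hA x]
    simp
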